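/- **Proposition 3.2 (Decreasing rearrangement).** Let $d\ge 1$. For $C\subset\mathbb Z^d$ let $\Theta_d(C)=\{(x,y)\in\mathbb Z^d\times\mathbb Z^d:\ |x-y|=1,\ x\in C,\ y\notin C\}$, where $|\cdot|$ is the Euclidean norm; $\#\Theta_d(C)$ is the edge perimeter of $C$. For $s\in\{1,\dots,d\}$ and $k\in\mathbb Z$ let $S_{s,k}(C)=\{x\in C:\ x_s=k\}$, and let $P(z_1,\dots,z_d)=(z_1,\dots,z_{s-1},z_{s+1},\dots,z_d)$. *Daisies.* A tuple $(p_1,\dots,p_m)$ of positive integers is $DO1$ if it is nonincreasing and $p_1-p_m\le 1$. For $m\ge1$, its value-change position is the least $j\ge 2$ with $p_j<p_{j-1}$, or $1$ if the tuple is constant. An $m$-dimensional daisy with leading coefficients $(p_1,\dots,p_m)$, a $DO1$ tuple, is a set $Q\subset\mathbb Z^m$ which is either the box $B=\{1,\dots,p_1\}\times\dots\times\{1,\dots,p_m\}$ (a perfect daisy), or, for $m\ge 2$, a union $B\cup R'$ of the following kind: if $t$ is the value-change position of $(p_1,\dots,p_m)$, then $R'=\{z\in\mathbb Z^m:\ z_t=p_t+1,\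 (z_1,\dots,z_{t-1},z_{t+1},\dots,z_m)\in R\}$, where $R$ is an $(m-1)$-dimensional daisy whose leading coefficients $(q_1,\dots,q_{m-1})$ are entrywise at most $(p_1,\dots,p_{t-1},p_{t+1},\dots,p_m)$, with strict inequality in at least one entry. The only $0$-dimensional daisy is the one-point set $\mathbb Z^0$. *Decreasing rearrangement.* Let $C\subset\mathbb Z^d$ be bounded and nonempty and let $s\in\{1,\dots,d\}$. Let $K_s=\{k\in\mathbb Z:\ S_{s,k}(C)\neq\emptyset\}$ and $n=\#K_s$. A set $C_s\subset\mathbb Z^d$ is a decreasing rearrangement of $C$ in the direction $\mathbf e_s$ if there is a bijection $\sigma:\{1,\dots,n\}\to K_s$ with $\#S_{s,\sigma(i)}(C)\ge\#S_{s,\sigma(j)}(C)$ for all $1\le i\le j\le n$ such that $S_{s,k}(C_s)\ne\emptyset$ exactly for $k\in\{1,\dots,n\}$ and, for each such $k$, the set $P\,S_{s,k}(C_s)$ is a $(d-1)$-dimensional daisy with $\#S_{s,\sigma(k)}(C)$ elements. Then $C$ has exactly one decreasing rearrangement $C_s$ in the direction $\mathbf e_s$, and $$\#\Theta_d(C_s)\le\#\Theta_d(C).$$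 -/

import Mathlib

/-- The edge boundary of `C ⊆ ℤ^d`: ordered pairs `(x, y)` at Euclidean distance `1`
(written as squared distance `1`) with `x ∈ C` and `y ∉ C`. -/
def edgeBoundary {d : ℕ} (C : Set (Fin d → ℤ)) : Set ((Fin d → ℤ) × (Fin d → ℤ)) :=
  {e | ∑ i, (e.1 i - e.2 i) ^ 2 = 1 ∧ e.1 ∈ C ∧ e.2 ∉ C}

/-- The edge perimeter: the cardinality of the edge boundary. -/
noncomputable def edgePerimeter {d : ℕ} (C : Set (Fin d → ℤ)) : ℕ∞ :=
  (edgeBoundary C).encard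

/-- The section of `C` orthogonal to the `s`-th coordinate direction at height `k`. -/
def latticeSection {d : ℕ} (s : Fin d) (k : ℤ) (C : Set (Fin d → ℤ)) : Set (Fin d → ℤ) :=
  {x | x ∈ C ∧ x s = k}

/-- A tuple of positive integers which is nonincreasing and has oscillation at most `1`. -/
structure IsDO1 {k : ℕ} (p : Fin k → ℕ) : Prop where
  pos : ∀ i, 1 ≤ p i
  antitone : Antitone p
  osc : ∀ i j, p i ≤ p j + 1

/-- The box `{1, …, p₁} × ⋯ × {1, …, pₖ}`; it is a perfect daisy when `p` is a DO1 tuple. -/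
def daisyBox {k : ℕ} (p : Fin k → ℕ) : Set (Fin k → ℤ) :=
  {x | ∀ i, 1 ≤ x i ∧ x i ≤ (p i : ℤ)}

/-- The value-change position of a DO1 tuple: the first position whose entry is smaller than
the preceding entry, or the first position of all if the tuple is constant. -/
def valueChange {k : ℕ} (p : Fin (k + 1) → ℕ) : Fin (k + 1) :=
  if h : ∃ j : Fin k, p j.succ < p j.castSucc then (Fin.find _ h).succ else 0

/-- `TupleLT a b` says that the tuple `b` (of length `n + 1`) is larger than the tuple `a` (of
length `n`): the entries of `a` are at most those of `b` with the value-change position left out,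
and one of these inequalities is strict. -/
def TupleLT {n : ℕ} (a : Fin n → ℕ) (b : Fin (n + 1) → ℕ) : Prop :=
  (∀ i, a i ≤ b ((valueChange b).succAbove i)) ∧ ∃ i, a i < b ((valueChange b).succAbove i)

/-- `IsDaisyWith p Q`: `Q` is a `d`-dimensional daisy whose top-dimensional constituent is the
perfect daisy with coefficients `p`. Either `Q` is that perfect daisy, or `Q` is its union with
the remaining, lower-dimensional constituents. The latter form a daisy of one dimension less,
with smaller leading coefficients, placed in the hyperplane `x_s = p_s + 1`, where `s` is the
value-change position of `p`. By strictness in `TupleLT` every constituent that is added has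
dimension at least `1`. The only `0`-dimensional daisy is the one-point set. -/
inductive IsDaisyWith : {d : ℕ} → (Fin d → ℕ) → Set (Fin d → ℤ) → Prop
  | perfect {d : ℕ} (p : Fin d → ℕ) (hp : IsDO1 p) : IsDaisyWith p (daisyBox p)
  | layer {d : ℕ} (p : Fin (d + 1) → ℕ) (hp : IsDO1 p) (q : Fin d → ℕ) (R : Set (Fin d → ℤ))
      (hR : IsDaisyWith q R) (hlt : TupleLT q p) :
      IsDaisyWith p (daisyBox p ∪
        (fun x => (valueChange p).insertNth (p (valueChange p) + 1 : ℤ) x) '' R)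

/-- `Q` is a `d`-dimensional daisy. -/
def IsDaisy {d : ℕ} (Q : Set (Fin d → ℤ)) : Prop :=
  ∃ p : Fin d → ℕ, IsDaisyWith p Q

/-- `C'` is the decreasing rearrangement of `C` in the `s`-th direction: after the nonempty
sections of `C` orthogonal to that direction have been listed in order `σ` of decreasing size,
the nonempty sections of `C'` are those at heights `1, …, n`, and the projection of the section
at the `i`-th height is a daisy with as many points as the `i`-th listed section of `C`. -/
def IsDecreasingRearrangement {d : ℕ} (s : Fin (d + 1)) (C C' : Set (Fin (d + 1) → ℤ)) : Prop :=
  ∃ (n : ℕ) (σ : Fin n ≃ {k : ℤ // (latticeSection s k C).Nonempty}),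
    (∀ i j, i ≤ j →
      (latticeSection s (σ j) C).encard ≤ (latticeSection s (σ i) C).encard) ∧
    (∀ k : ℤ, (latticeSection s k C').Nonempty ↔ 1 ≤ k ∧ k ≤ n) ∧
    ∀ i : Fin n,
      IsDaisy (s.removeNth '' latticeSection s ((i : ℤ) + 1) C') ∧
      (s.removeNth '' latticeSection s ((i : ℤ) + 1) C').encard =
        (latticeSection s (σ i) C).encard

/-!
Call a pair of neighbouring points of `C` an inner edge. The edge perimeter of a finite
`C ⊆ ℤ^d` is `2 * (d * #C - innerEdges C)`, so rearranging must not lose inner edges. The daisies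
are the initial segments of one enumeration of the points with positive coordinates: there is
exactly one for each cardinality, and they are nested. Hence stacking daisies in decreasing order
makes the number of vertical edges as large as the section sizes allow, and what is left is that
no section has more inner edges than the daisy replacing it, that is, the edge-isoperimetric
inequality in one dimension less.

The edge-isoperimetric inequality is proved by induction on the dimension and on `#C`. Slice `C`
in a direction with the largest number `k` of sections, stack the sections as daisies and remove
the smallest layer, which has at most `k ^ (d - 1)` points. It remains to see that the daisy with
`#C` points also loses at least as many edges when its last points, equally many, are removed. This
is an inequality between edge numbers of daisies, which follows from a submodularity argument: two
daisies in a box are exchanged for the union and the intersection of one with the reflection of the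
other.
-/

open Finset

/-- The nonincreasing tuple of length `d` with entry sum `N` and oscillation at most one. -/
def balancedTuple (d N : ℕ) (i : Fin d) : ℕ := if (i : ℕ) < N % d then N / d + 1 else N / d

/-- The number of lattice points of the box with side lengths `balancedTuple d N`. -/
def boxVolume (d N : ℕ) : ℕ := ∏ i, balancedTuple d N i

/-- The position at which `balancedTuple (d + 1) N` and `balancedTuple (d + 1) (N + 1)` differ. -/
def growthPos (d N : ℕ) : Fin (d + 1) := ⟨N % (d + 1), Nat.mod_lt _ d.succ_pos⟩

/-- The entry sum of `balancedTuple (d + 1) N` with the entry at `growthPos d N` left out. -/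
def faceIndex (d N : ℕ) : ℕ := N - N / (d + 1)

theorem exists_eq_mul_add (d N : ℕ) : ∃ a j, j ≤ d ∧ N = (d + 1) * a + j :=
  ⟨N / (d + 1), N % (d + 1), Nat.lt_succ_iff.mp (Nat.mod_lt _ d.succ_pos),
    (Nat.div_add_mod _ _).symm⟩

theorem succ_mul_add_div {d j : ℕ} (hj : j ≤ d) (a : ℕ) : ((d + 1) * a + j) / (d + 1) = a := by
  rw [Nat.mul_add_div d.succ_pos, Nat.div_eq_of_lt (by omega), add_zero]

theorem succ_mul_add_mod {d j : ℕ} (hj : j ≤ d) (a : ℕ) : ((d + 1) * a + j) % (d + 1) = j := by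
  rw [Nat.mul_add_mod, Nat.mod_eq_of_lt (by omega)]

theorem growthPos_mul_add {d j : ℕ} (hj : j ≤ d) (a : ℕ) :
    growthPos d ((d + 1) * a + j) = ⟨j, by omega⟩ :=
  Fin.ext (succ_mul_add_mod hj a)

theorem faceIndex_mul_add {d j : ℕ} (hj : j ≤ d) (a : ℕ) :
    faceIndex d ((d + 1) * a + j) = d * a + j := by
  rw [faceIndex, succ_mul_add_div hj, Nat.succ_mul]
  omega

theorem balancedTuple_mul_add {d j : ℕ} (hj : j ≤ d) (a : ℕ) (i : Fin d) :
    balancedTuple d (d * a + j) i = if (i : ℕ) < j then a + 1 else a := by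
  unfold balancedTuple
  rcases hj.lt_or_eq with h | rfl
  · rw [Nat.mul_add_div i.pos, Nat.div_eq_of_lt h, Nat.mul_add_mod, Nat.mod_eq_of_lt h, add_zero]
  · rw [← Nat.mul_succ, Nat.mul_mod_right, Nat.mul_div_cancel_left _ i.pos,
      if_neg i.val.not_lt_zero, if_pos i.isLt]

theorem balancedTuple_eq_insertNth (d N : ℕ) :
    balancedTuple (d + 1) N =
      (growthPos d N).insertNth (N / (d + 1)) (balancedTuple d (faceIndex d N)) := by
  obtain ⟨a, j, hj, rfl⟩ := exists_eq_mul_add d N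
  rw [growthPos_mul_add hj, faceIndex_mul_add hj, succ_mul_add_div hj, Fin.eq_insertNth_iff]
  refine ⟨by simp [balancedTuple_mul_add (Nat.le_succ_of_le hj)], funext fun i => ?_⟩
  rw [Fin.removeNth, balancedTuple_mul_add (Nat.le_succ_of_le hj), balancedTuple_mul_add hj]
  grind [Fin.succAbove]

theorem balancedTuple_succ (d N : ℕ) :
    balancedTuple (d + 1) (N + 1) =
      (growthPos d N).insertNth (N / (d + 1) + 1) (balancedTuple d (faceIndex d N)) := by
  obtain ⟨a, j, hj, rfl⟩ := exists_eq_mul_add d N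
  rw [growthPos_mul_add hj, faceIndex_mul_add hj, succ_mul_add_div hj, Fin.eq_insertNth_iff,
    add_assoc]
  refine ⟨by simp [balancedTuple_mul_add (Nat.succ_le_succ hj)], funext fun i => ?_⟩
  rw [Fin.removeNth, balancedTuple_mul_add (Nat.succ_le_succ hj), balancedTuple_mul_add hj]
  grind [Fin.succAbove]

theorem balancedTuple_mono (d : ℕ) : Monotone (balancedTuple d) := by
  obtain _ | d := d
  · exact fun _ _ _ i => i.elim0
  refine monotone_nat_of_le_succ fun N => ?_
  rw [balancedTuple_eq_insertNth, balancedTuple_succ, Fin.insertNth_le_iff]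
  simp

theorem balancedTuple_pos {d N : ℕ} (h : d ≤ N) (i : Fin d) : 1 ≤ balancedTuple d N i := by
  have : 1 ≤ N / d := (Nat.one_le_div_iff i.pos).2 h
  unfold balancedTuple
  split_ifs <;> omega

theorem div_le_balancedTuple (d N : ℕ) (i : Fin d) : N / d ≤ balancedTuple d N i := by
  unfold balancedTuple
  split_ifs <;> omega

theorem boxVolume_zero_right (d : ℕ) : boxVolume (d + 1) 0 = 0 := by
  simp [boxVolume, balancedTuple]

theorem boxVolume_eq_mul_face (d N : ℕ) :
    boxVolume (d + 1) N = N / (d + 1) * boxVolume d (faceIndex d N) := by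
  rw [boxVolume, balancedTuple_eq_insertNth, Fin.prod_insertNth, boxVolume]

theorem boxVolume_succ_eq_mul_face (d N : ℕ) :
    boxVolume (d + 1) (N + 1) = (N / (d + 1) + 1) * boxVolume d (faceIndex d N) := by
  rw [boxVolume, balancedTuple_succ, Fin.prod_insertNth, boxVolume]

theorem boxVolume_succ (d N : ℕ) :
    boxVolume (d + 1) (N + 1) = boxVolume (d + 1) N + boxVolume d (faceIndex d N) := by
  rw [boxVolume_succ_eq_mul_face, boxVolume_eq_mul_face, Nat.succ_mul]

theorem boxVolume_mono (d : ℕ) : Monotone (boxVolume d) := fun _ _ h =>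
  prod_le_prod' fun i _ => balancedTuple_mono d h i

theorem boxVolume_pos {d N : ℕ} (h : d ≤ N) : 0 < boxVolume d N :=
  prod_pos fun i _ => balancedTuple_pos h i

theorem pow_div_le_boxVolume (d N : ℕ) : (N / d) ^ d ≤ boxVolume d N :=
  calc (N / d) ^ d = ∏ _i : Fin d, N / d := by simp
    _ ≤ boxVolume d N := prod_le_prod' fun i _ => div_le_balancedTuple d N i

theorem boxVolume_self (d : ℕ) : boxVolume d d = 1 := by
  have h := balancedTuple_mul_add d.zero_le 1
  simp only [mul_one, add_zero, not_lt_zero, if_false] at h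
  simp [boxVolume, h]

theorem le_faceIndex {d N : ℕ} (h : d ≤ N) : d ≤ faceIndex d N := by
  obtain ⟨a, j, hj, rfl⟩ := exists_eq_mul_add d N
  rw [faceIndex_mul_add hj]
  rcases a with _ | a
  · simpa using h
  · nlinarith

theorem le_boxVolume (d n : ℕ) : n ≤ boxVolume (d + 1) (d + n) := by
  induction n with
  | zero => exact Nat.zero_le _
  | succ n ih =>
    have := boxVolume_pos (le_faceIndex (Nat.le_add_right d n))
    rw [← add_assoc, boxVolume_succ]
    omega

theorem exists_lt_boxVolume (d n : ℕ) : ∃ N, n < boxVolume (d + 1) (N + 1) :=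
  ⟨d + n, le_boxVolume d (n + 1)⟩

/-- The entry sum of the largest box `balancedTuple (d + 1) N` with at most `n` points. -/
def boxLevel (d n : ℕ) : ℕ := Nat.find (exists_lt_boxVolume d n)

theorem boxVolume_boxLevel_le (d n : ℕ) : boxVolume (d + 1) (boxLevel d n) ≤ n := by
  rcases h : boxLevel d n with _ | N
  · exact (boxVolume_zero_right d).trans_le n.zero_le
  · exact not_lt.mp (Nat.find_min (exists_lt_boxVolume d n) (show N < boxLevel d n by omega))

theorem exists_eq_boxVolume_add (d n : ℕ) :
    ∃ N r, r < boxVolume d (faceIndex d N) ∧ n = boxVolume (d + 1) N + r := by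
  have hle := boxVolume_boxLevel_le d n
  have hlt : n < boxVolume (d + 1) (boxLevel d n + 1) := Nat.find_spec (exists_lt_boxVolume d n)
  rw [boxVolume_succ] at hlt
  exact ⟨boxLevel d n, n - boxVolume (d + 1) (boxLevel d n), by omega, by omega⟩

theorem exists_eq_boxVolume_add_of_pos (d : ℕ) {n : ℕ} (hn : 0 < n) :
    ∃ N r, d + 1 ≤ N ∧ r < boxVolume d (faceIndex d N) ∧ n = boxVolume (d + 1) N + r := by
  obtain ⟨N, r, hr, rfl⟩ := exists_eq_boxVolume_add d n
  refine ⟨N, r, ?_, hr, rfl⟩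
  by_contra! h
  have := boxVolume_mono (d + 1) h
  rw [boxVolume_succ, boxVolume_self] at this
  omega

theorem boxLevel_boxVolume_add {d N r : ℕ} (hr : r < boxVolume d (faceIndex d N)) :
    boxLevel d (boxVolume (d + 1) N + r) = N := by
  refine (Nat.find_eq_iff _).2 ⟨by rw [boxVolume_succ]; omega, fun M hM => ?_⟩
  exact not_lt.mpr ((boxVolume_mono (d + 1) hM).trans (Nat.le_add_right _ r))

/-- The embedding of `ℤ^d` onto the hyperplane `x s = k` of `ℤ^(d + 1)`. -/
def layerEmb {d : ℕ} (s : Fin (d + 1)) (k : ℤ) : (Fin d → ℤ) ↪ (Fin (d + 1) → ℤ) :=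
  ⟨fun x => s.insertNth k x, Fin.insertNth_right_injective (α := fun _ => ℤ) k⟩

@[simp]
theorem layerEmb_apply_same {d : ℕ} (s : Fin (d + 1)) (k : ℤ) (x : Fin d → ℤ) :
    layerEmb s k x s = k :=
  Fin.insertNth_apply_same (α := fun _ => ℤ) s k x

@[simp]
theorem layerEmb_apply_succAbove {d : ℕ} (s : Fin (d + 1)) (k : ℤ) (x : Fin d → ℤ) (i : Fin d) :
    layerEmb s k x (s.succAbove i) = x i :=
  Fin.insertNth_apply_succAbove (α := fun _ => ℤ) s k x i

@[simp]
theorem removeNth_layerEmb {d : ℕ} (s : Fin (d + 1)) (k : ℤ) (x : Fin d → ℤ) :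
    s.removeNth (layerEmb s k x) = x :=
  Fin.removeNth_insertNth (α := fun _ => ℤ) s k x

theorem layerEmb_removeNth {d : ℕ} (s : Fin (d + 1)) (x : Fin (d + 1) → ℤ) :
    layerEmb s (x s) (s.removeNth x) = x :=
  Fin.insertNth_self_removeNth s x

theorem mem_map_layerEmb {d : ℕ} {s : Fin (d + 1)} {k : ℤ} {A : Finset (Fin d → ℤ)}
    {x : Fin (d + 1) → ℤ} : x ∈ A.map (layerEmb s k) ↔ x s = k ∧ s.removeNth x ∈ A := by
  rw [mem_map]
  constructor
  · rintro ⟨y, hy, rfl⟩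
    exact ⟨layerEmb_apply_same s k y, (removeNth_layerEmb s k y).symm ▸ hy⟩
  · rintro ⟨rfl, h⟩
    exact ⟨_, h, layerEmb_removeNth s x⟩

/-- The box with side lengths `balancedTuple d N`. -/
noncomputable def balancedBox (d N : ℕ) : Finset (Fin d → ℤ) :=
  Icc 1 fun i => (balancedTuple d N i : ℤ)

theorem mem_balancedBox {d N : ℕ} {x : Fin d → ℤ} :
    x ∈ balancedBox d N ↔ ∀ i, 1 ≤ x i ∧ x i ≤ balancedTuple d N i := by
  simp [balancedBox, Pi.le_def, forall_and]

theorem coe_balancedBox (d N : ℕ) :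
    (balancedBox d N : Set (Fin d → ℤ)) = daisyBox (balancedTuple d N) :=
  Set.ext fun _ => mem_balancedBox

theorem card_balancedBox (d N : ℕ) : #(balancedBox d N) = boxVolume d N := by
  simp [balancedBox, Pi.card_Icc, boxVolume]

theorem mem_balancedBox_growthPos {d N : ℕ} {x : Fin (d + 1) → ℤ} :
    x ∈ balancedBox (d + 1) N ↔
      (1 ≤ x (growthPos d N) ∧ x (growthPos d N) ≤ (N / (d + 1) : ℕ)) ∧
        (growthPos d N).removeNth x ∈ balancedBox d (faceIndex d N) := by
  simp only [mem_balancedBox, balancedTuple_eq_insertNth,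
    Fin.forall_iff_succAbove (growthPos d N), Fin.insertNth_apply_same,
    Fin.insertNth_apply_succAbove, Fin.removeNth]

theorem mem_balancedBox_succ {d N : ℕ} {x : Fin (d + 1) → ℤ} :
    x ∈ balancedBox (d + 1) (N + 1) ↔
      (1 ≤ x (growthPos d N) ∧ x (growthPos d N) ≤ (N / (d + 1) + 1 : ℕ)) ∧
        (growthPos d N).removeNth x ∈ balancedBox d (faceIndex d N) := by
  simp only [mem_balancedBox, balancedTuple_succ, Fin.forall_iff_succAbove (growthPos d N),
    Fin.insertNth_apply_same, Fin.insertNth_apply_succAbove, Fin.removeNth]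

theorem balancedBox_succ (d N : ℕ) :
    balancedBox (d + 1) (N + 1) = balancedBox (d + 1) N ∪
      (balancedBox d (faceIndex d N)).map (layerEmb (growthPos d N) (N / (d + 1) + 1 : ℕ)) := by
  ext x
  rw [mem_union, mem_map_layerEmb, mem_balancedBox_succ, mem_balancedBox_growthPos]
  generalize N / (d + 1) = a
  grind

/-- An enumeration of the points of `ℤ^d` with positive coordinates (for `d ≥ 1`) whose initial
segments are the daisies: the box `balancedBox (d + 1) N` is extended to
`balancedBox (d + 1) (N + 1)` by the points of the new face, in the order of `daisySeq d`. -/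
def daisySeq : (d : ℕ) → ℕ → Fin d → ℤ
  | 0, _ => Fin.elim0
  | d + 1, n => layerEmb (growthPos d (boxLevel d n)) (boxLevel d n / (d + 1) + 1 : ℕ)
      (daisySeq d (n - boxVolume (d + 1) (boxLevel d n)))

theorem daisySeq_boxVolume_add {d N r : ℕ} (hr : r < boxVolume d (faceIndex d N)) :
    daisySeq (d + 1) (boxVolume (d + 1) N + r) =
      layerEmb (growthPos d N) (N / (d + 1) + 1 : ℕ) (daisySeq d r) := by
  rw [daisySeq, boxLevel_boxVolume_add hr, Nat.add_sub_cancel_left]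

/-- The initial segment of length `n` of `daisySeq d`. -/
def daisy (d n : ℕ) : Finset (Fin d → ℤ) := (range n).image (daisySeq d)

theorem daisy_mono (d : ℕ) : Monotone (daisy d) := fun _ _ h =>
  image_subset_image (range_subset_range.2 h)

theorem daisy_zero_right (d : ℕ) : daisy d 0 = ∅ := rfl

theorem daisy_boxVolume_add_eq_union {d N r : ℕ} (hr : r ≤ boxVolume d (faceIndex d N)) :
    daisy (d + 1) (boxVolume (d + 1) N + r) = daisy (d + 1) (boxVolume (d + 1) N) ∪
      (daisy d r).map (layerEmb (growthPos d N) (N / (d + 1) + 1 : ℕ)) := by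
  unfold daisy
  rw [range_add_eq_union, image_union, map_eq_image, map_eq_image, image_image, image_image]
  congr 1
  exact image_congr fun k hk => daisySeq_boxVolume_add ((mem_range.mp hk).trans_le hr)

theorem daisy_boxVolume (d N : ℕ) : daisy d (boxVolume d N) = balancedBox d N := by
  induction d generalizing N with
  | zero =>
    ext x
    simp [mem_balancedBox, daisy, boxVolume, Subsingleton.elim x (daisySeq 0 0)]
  | succ d ihd =>
    induction N with
    | zero =>
      rw [boxVolume_zero_right, daisy_zero_right, eq_comm, ← card_eq_zero, card_balancedBox,
        boxVolume_zero_right]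
    | succ N ih =>
      rw [boxVolume_succ, daisy_boxVolume_add_eq_union le_rfl, ih, ihd, balancedBox_succ]

theorem daisy_boxVolume_add {d N r : ℕ} (hr : r ≤ boxVolume d (faceIndex d N)) :
    daisy (d + 1) (boxVolume (d + 1) N + r) = balancedBox (d + 1) N ∪
      (daisy d r).map (layerEmb (growthPos d N) (N / (d + 1) + 1 : ℕ)) := by
  rw [daisy_boxVolume_add_eq_union hr, daisy_boxVolume]

theorem daisy_subset_balancedBox {d N n : ℕ} (h : n ≤ boxVolume d N) :
    daisy d n ⊆ balancedBox d N :=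
  (daisy_mono d h).trans_eq (daisy_boxVolume d N)

theorem daisySeq_injOn (d N : ℕ) : Set.InjOn (daisySeq d) (range (boxVolume d N)) := by
  rw [← card_image_iff, ← daisy, daisy_boxVolume, card_balancedBox, card_range]

theorem card_daisy {d N n : ℕ} (h : n ≤ boxVolume d N) : #(daisy d n) = n := by
  have hinj := (daisySeq_injOn d N).mono (coe_subset.mpr (range_subset_range.mpr h))
  rw [daisy, card_image_of_injOn hinj, card_range]

theorem card_daisy_succ (d n : ℕ) : #(daisy (d + 1) n) = n := card_daisy (le_boxVolume d n)

theorem card_daisy_of_le_card {d n : ℕ} {A : Finset (Fin d → ℤ)} (h : n ≤ #A) :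
    #(daisy d n) = n := by
  obtain _ | d := d
  · exact card_daisy (N := 0) (h.trans (by simpa [boxVolume] using card_le_one_of_subsingleton A))
  · exact card_daisy_succ d n

theorem daisy_nonempty {d n : ℕ} (hn : 0 < n) : (daisy d n).Nonempty :=
  (nonempty_range_iff.mpr hn.ne').image _

theorem one_le_of_mem_daisy {d n : ℕ} {x : Fin d → ℤ} (hx : x ∈ daisy d n) (i : Fin d) :
    1 ≤ x i := by
  obtain _ | d := d
  · exact i.elim0
  · exact (mem_balancedBox.mp (daisy_subset_balancedBox (le_boxVolume d n) hx) i).1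

theorem mem_daisy_of_le {d n : ℕ} {x y : Fin d → ℤ} (hx : x ∈ daisy d n) (hyx : y ≤ x)
    (hy : ∀ i, 1 ≤ y i) : y ∈ daisy d n := by
  induction d generalizing n with
  | zero => rwa [Subsingleton.elim y x]
  | succ d ih =>
    obtain ⟨N, r, hr, rfl⟩ := exists_eq_boxVolume_add d n
    rw [daisy_boxVolume_add hr.le, mem_union, mem_map_layerEmb] at hx ⊢
    rcases hx with hbox | ⟨htop, hrest⟩
    · rw [mem_balancedBox] at hbox ⊢
      exact Or.inl fun i => ⟨hy i, (hyx i).trans (hbox i).2⟩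
    · rcases (hyx (growthPos d N)).lt_or_eq with hlt | heq
      · have hbox := mem_balancedBox.mp (daisy_subset_balancedBox hr.le hrest)
        refine Or.inl (mem_balancedBox_growthPos.mpr ⟨⟨hy _, ?_⟩, mem_balancedBox.mpr ?_⟩)
        · exact Int.lt_add_one_iff.mp (by simpa only [htop, Nat.cast_succ] using hlt)
        · exact fun i => ⟨hy _, (hyx _).trans (hbox i).2⟩
      · exact Or.inr ⟨heq.trans htop, ih hrest (fun i => hyx _) fun i => hy _⟩

/-- The number of unordered pairs of neighbouring points of `A`. -/
def innerEdges {d : ℕ} (A : Finset (Fin d → ℤ)) : ℕ :=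
  ∑ i, #{x ∈ A | x + Pi.single i 1 ∈ A}

theorem innerEdges_add_le {d : ℕ} (A B : Finset (Fin d → ℤ)) :
    innerEdges A + innerEdges B ≤ innerEdges (A ∪ B) + innerEdges (A ∩ B) := by
  unfold innerEdges
  rw [← sum_add_distrib, ← sum_add_distrib]
  refine sum_le_sum fun i _ => ?_
  rw [← card_union_add_card_inter]
  refine add_le_add (card_le_card fun x => ?_) (card_le_card fun x => ?_) <;>
    simp only [mem_union, mem_inter, mem_filter] <;> tauto

theorem innerEdges_image_sub {d : ℕ} (c : Fin d → ℤ) (A : Finset (Fin d → ℤ)) :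
    innerEdges (A.image (c - ·)) = innerEdges A := by
  have hmem (x) : x ∈ A.image (c - ·) ↔ c - x ∈ A := by
    rw [mem_image]
    exact ⟨by rintro ⟨y, hy, rfl⟩; rwa [sub_sub_cancel], fun h => ⟨_, h, sub_sub_cancel c x⟩⟩
  refine sum_congr rfl fun i _ => card_equiv (Equiv.subLeft (c - Pi.single i 1)) fun x => ?_
  simp only [mem_filter, hmem, Equiv.subLeft_apply]
  rw [and_comm, sub_right_comm c, sub_add_cancel, ← sub_sub]

theorem innerEdges_of_card_le_one {d : ℕ} {A : Finset (Fin d → ℤ)} (h : #A ≤ 1) :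
    innerEdges A = 0 := by
  refine sum_eq_zero fun i _ => card_eq_zero.mpr (filter_eq_empty_iff.mpr fun x hx hx' => ?_)
  simpa using congrFun (card_le_one.mp h _ hx _ hx') i

/-- The number of inner edges of the daisy with `n` points. The `k`-th point of `daisySeq d` is
joined to an earlier one in each of the directions counted here. -/
def daisyEdges (d n : ℕ) : ℕ := ∑ k ∈ range n, #{i | 1 < daisySeq d k i}

theorem daisyEdges_zero_right (d : ℕ) : daisyEdges d 0 = 0 := rfl

theorem daisyEdges_boxVolume_add {d N r : ℕ} (hN : d + 1 ≤ N)
    (hr : r ≤ boxVolume d (faceIndex d N)) :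
    daisyEdges (d + 1) (boxVolume (d + 1) N + r) =
      daisyEdges (d + 1) (boxVolume (d + 1) N) + (r + daisyEdges d r) := by
  have hheight : 1 < ((N / (d + 1) + 1 : ℕ) : ℤ) := by
    exact_mod_cast Nat.lt_succ_of_le ((Nat.one_le_div_iff d.succ_pos).2 hN)
  have hstep : ∀ k ∈ range r,
      #{i | 1 < daisySeq (d + 1) (boxVolume (d + 1) N + k) i} = 1 + #{i | 1 < daisySeq d k i} := by
    intro k hk
    rw [daisySeq_boxVolume_add ((mem_range.mp hk).trans_le hr)]
    simp only [card_filter, Fin.sum_univ_succAbove _ (growthPos d N), layerEmb_apply_same,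
      layerEmb_apply_succAbove, if_pos hheight]
  unfold daisyEdges
  rw [sum_range_add, sum_congr rfl hstep, sum_add_distrib, sum_const, card_range, smul_eq_mul,
    mul_one]

theorem daisyEdges_eq_sum {d n : ℕ} (h : #(daisy d n) = n) :
    daisyEdges d n = ∑ i, #{x ∈ daisy d n | 1 < x i} := by
  have hinj : Set.InjOn (daisySeq d) (range n) := card_image_iff.mp (by rwa [card_range])
  simp only [card_filter, daisyEdges]
  rw [sum_comm]
  exact sum_congr rfl fun i _ => by rw [daisy, sum_image hinj]

theorem innerEdges_daisy {d n : ℕ} (h : #(daisy d n) = n) :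
    innerEdges (daisy d n) = daisyEdges d n := by
  rw [daisyEdges_eq_sum h]
  refine sum_congr rfl fun i _ => card_equiv (Equiv.addRight (Pi.single i 1)) fun x => ?_
  simp only [mem_filter, Equiv.coe_addRight, Pi.add_apply, Pi.single_eq_same]
  constructor
  · rintro ⟨hx, hxi⟩
    exact ⟨hxi, by linarith [one_le_of_mem_daisy hx i]⟩
  · rintro ⟨hxi, hlt⟩
    refine ⟨mem_daisy_of_le hxi (le_add_of_nonneg_right (Pi.single_nonneg.mpr zero_le_one))
      fun k => ?_, hxi⟩
    rcases eq_or_ne k i with rfl | hki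
    · linarith
    · simpa [hki] using one_le_of_mem_daisy hxi k

section Sections

variable {d : ℕ} {s : Fin (d + 1)} {k : ℤ} {A : Finset (Fin (d + 1) → ℤ)}

/-- The section of `A` by the hyperplane `x s = k`, projected to `ℤ^d`. -/
noncomputable def sectionAt (s : Fin (d + 1)) (k : ℤ) (A : Finset (Fin (d + 1) → ℤ)) :
    Finset (Fin d → ℤ) :=
  A.preimage (layerEmb s k) (layerEmb s k).injective.injOn

theorem mem_sectionAt {y : Fin d → ℤ} : y ∈ sectionAt s k A ↔ layerEmb s k y ∈ A := mem_preimage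

theorem map_sectionAt (s : Fin (d + 1)) (k : ℤ) (A : Finset (Fin (d + 1) → ℤ)) :
    (sectionAt s k A).map (layerEmb s k) = {x ∈ A | x s = k} := by
  ext x
  rw [mem_map_layerEmb, mem_sectionAt, mem_filter, and_comm]
  refine and_congr_left ?_
  rintro rfl
  rw [layerEmb_removeNth]

theorem card_sectionAt (s : Fin (d + 1)) (k : ℤ) (A : Finset (Fin (d + 1) → ℤ)) :
    #(sectionAt s k A) = #{x ∈ A | x s = k} := by
  rw [← map_sectionAt, card_map]

theorem sectionAt_nonempty_iff : (sectionAt s k A).Nonempty ↔ k ∈ A.image (· s) := by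
  rw [← map_nonempty (f := layerEmb s k), map_sectionAt, filter_nonempty_iff, mem_image]

theorem sum_card_sectionAt {K : Finset ℤ} (hK : ∀ x ∈ A, x s ∈ K) :
    ∑ k ∈ K, #(sectionAt s k A) = #A := by
  simp only [card_sectionAt]
  exact (card_eq_sum_card_fiberwise hK).symm

theorem layerEmb_add_single_self (s : Fin (d + 1)) (k : ℤ) (y : Fin d → ℤ) :
    layerEmb s k y + Pi.single s 1 = layerEmb s (k + 1) y := by
  ext l
  rcases Fin.eq_self_or_eq_succAbove s l with rfl | ⟨l, rfl⟩ <;> simp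

theorem layerEmb_add_single_succAbove (s : Fin (d + 1)) (k : ℤ) (y : Fin d → ℤ) (i : Fin d) :
    layerEmb s k y + Pi.single (s.succAbove i) 1 = layerEmb s k (y + Pi.single i 1) := by
  ext l
  rcases Fin.eq_self_or_eq_succAbove s l with rfl | ⟨l, rfl⟩
  · simp [(Fin.succAbove_ne _ _).symm]
  · simp [Pi.single_apply]

theorem innerEdges_eq_sum_sectionAt {K : Finset ℤ} (hK : ∀ x ∈ A, x s ∈ K) :
    innerEdges A = #{x ∈ A | x + Pi.single s 1 ∈ A} + ∑ k ∈ K, innerEdges (sectionAt s k A) := by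
  unfold innerEdges
  rw [Fin.sum_univ_succAbove _ s, sum_comm]
  congr 1
  refine sum_congr rfl fun i _ => ?_
  rw [← sum_card_sectionAt (s := s) fun x hx => hK x (mem_filter.mp hx).1]
  refine sum_congr rfl fun k _ => congrArg card ?_
  ext y
  simp only [mem_sectionAt, mem_filter, layerEmb_add_single_succAbove]

theorem card_filter_add_single_mem_le (s : Fin (d + 1)) (k : ℤ) (A : Finset (Fin (d + 1) → ℤ)) :
    #{x ∈ A | x + Pi.single s 1 ∈ A} + #(sectionAt s k A) ≤ #A := by
  rw [card_sectionAt, ← card_filter_add_card_filter_not (s := A) (· s = k), add_comm]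
  refine Nat.add_le_add_left ?_ _
  -- Below height `k` an edge is sent to its lower endpoint, from height `k` on to its upper one.
  refine card_le_card_of_injOn (fun x => if x s < k then x else x + Pi.single s 1) ?_ ?_
  · intro x hx
    simp only [coe_filter, Set.mem_ofPred_eq] at hx ⊢
    split_ifs with h
    · exact ⟨hx.1, h.ne⟩
    · exact ⟨hx.2, by rw [Pi.add_apply, Pi.single_eq_same]; omega⟩
  · intro x _ y _ hxy
    simp only at hxy
    split_ifs at hxy with hx hy hy
    · exact hxy
    · have := congrFun hxy s
      simp only [Pi.add_apply, Pi.single_eq_same] at this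
      omega
    · have := congrFun hxy s
      simp only [Pi.add_apply, Pi.single_eq_same] at this
      omega
    · exact add_right_cancel hxy

end Sections

/-- The edge-isoperimetric inequality in dimension `d`: daisies have the largest number of inner
edges among the sets with a given number of points. -/
def DaisiesAreOptimal (d : ℕ) : Prop :=
  ∀ A : Finset (Fin d → ℤ), innerEdges A ≤ daisyEdges d #A

section Exchange

variable {d N x y : ℕ}

theorem corner_notMem_daisy (hx : x < boxVolume d N) :
    (fun i => (balancedTuple d N i : ℤ)) ∉ daisy d x := by
  intro h
  have hsub : balancedBox d N ⊆ daisy d x := fun z hz =>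
    mem_daisy_of_le h (fun i => (mem_balancedBox.mp hz i).2) fun i => (mem_balancedBox.mp hz i).1
  have := card_le_card hsub
  rw [card_balancedBox, card_daisy hx.le] at this
  omega

theorem image_corner_sub_subset_balancedBox {A : Finset (Fin d → ℤ)} (hA : A ⊆ balancedBox d N) :
    A.image ((fun i => (balancedTuple d N i : ℤ)) + 1 - ·) ⊆ balancedBox d N := by
  rw [image_subset_iff]
  refine fun z hz => mem_balancedBox.mpr fun i => ?_
  have := mem_balancedBox.mp (hA hz) i
  simp only [Pi.sub_apply, Pi.add_apply, Pi.one_apply]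
  omega

theorem corner_mem_image_sub_daisy (c : Fin d → ℤ) (hy : 0 < y) :
    c ∈ (daisy d y).image (c + 1 - ·) := by
  obtain ⟨w, hw⟩ := daisy_nonempty (d := d) hy
  refine mem_image.mpr ⟨1, mem_daisy_of_le hw (one_le_of_mem_daisy hw) fun _ => le_rfl, ?_⟩
  exact add_sub_cancel_right c 1

/-- The two daisies are replaced by the union and the intersection of the first with the
reflection of the second in the box. -/
theorem exists_daisyEdges_add_le (hd : DaisiesAreOptimal d) (hx : x < boxVolume d N) (hy₀ : 0 < y)
    (hy : y ≤ boxVolume d N) :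
    ∃ x' y', x < x' ∧ x' ≤ boxVolume d N ∧ x' + y' = x + y ∧
      daisyEdges d x + daisyEdges d y ≤ daisyEdges d x' + daisyEdges d y' := by
  let c : Fin d → ℤ := fun i => balancedTuple d N i
  let A := daisy d x
  let B := (daisy d y).image (c + 1 - ·)
  have hB : #B = y := by
    rw [card_image_of_injective _ sub_right_injective, card_daisy hy]
  have hlt : #A < #(A ∪ B) := by
    refine card_lt_card ((ssubset_iff_of_subset subset_union_left).mpr ⟨c, ?_, ?_⟩)
    · exact mem_union_right _ (corner_mem_image_sub_daisy c hy₀)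
    · exact corner_notMem_daisy hx
  have hbox : A ∪ B ⊆ balancedBox d N :=
    union_subset (daisy_subset_balancedBox hx.le)
      (image_corner_sub_subset_balancedBox (daisy_subset_balancedBox hy))
  refine ⟨#(A ∪ B), #(A ∩ B), ?_, ?_, ?_, ?_⟩
  · rwa [card_daisy hx.le] at hlt
  · exact (card_le_card hbox).trans_eq (card_balancedBox d N)
  · rw [card_union_add_card_inter, hB, card_daisy hx.le]
  · calc daisyEdges d x + daisyEdges d y = innerEdges A + innerEdges B := by
          rw [innerEdges_image_sub, innerEdges_daisy (card_daisy hx.le),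
            innerEdges_daisy (card_daisy hy)]
      _ ≤ innerEdges (A ∪ B) + innerEdges (A ∩ B) := innerEdges_add_le A B
      _ ≤ daisyEdges d #(A ∪ B) + daisyEdges d #(A ∩ B) := add_le_add (hd _) (hd _)

theorem daisyEdges_exchange (hd : DaisiesAreOptimal d) (hx : x ≤ boxVolume d N)
    (hy : y ≤ boxVolume d N) :
    daisyEdges d x + daisyEdges d y ≤
      daisyEdges d (min (x + y) (boxVolume d N)) + daisyEdges d (x + y - boxVolume d N) := by
  induction hk : boxVolume d N - x using Nat.strong_induction_on generalizing x y with
  | _ k ih =>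
  rcases hx.eq_or_lt with rfl | hx'
  · rw [min_eq_right (Nat.le_add_right _ _), Nat.add_sub_cancel_left]
  rcases y.eq_zero_or_pos with rfl | hy'
  · rw [add_zero, min_eq_left hx, Nat.sub_eq_zero_of_le hx]
  obtain ⟨x', y', hlt, hx₁, hadd, hle⟩ := exists_daisyEdges_add_le hd hx' hy' hy
  rw [← hadd]
  exact hle.trans (ih _ (by omega) hx₁ (by omega) rfl)

theorem daisyEdges_add_le (hd : DaisiesAreOptimal d) (h : x + y ≤ boxVolume d N) :
    daisyEdges d x + daisyEdges d y ≤ daisyEdges d (x + y) := by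
  have := daisyEdges_exchange hd (x := x) (y := y) (N := N) (by omega) (by omega)
  rwa [min_eq_left h, Nat.sub_eq_zero_of_le h, daisyEdges_zero_right, add_zero] at this

end Exchange

theorem sum_range_getD (l : List ℕ) {f : ℕ → ℕ} (hf : f 0 = 0) {n : ℕ} (hn : l.length ≤ n) :
    ∑ i ∈ range n, f (l.getD i 0) = (l.map f).sum := by
  induction l generalizing n with
  | nil => simp [hf]
  | cons a l ih =>
    obtain ⟨n, rfl⟩ := Nat.exists_eq_add_one_of_ne_zero (by rintro rfl; simp at hn : n ≠ 0)
    rw [sum_range_succ', List.map_cons, List.sum_cons, ← ih (Nat.le_of_succ_le_succ hn), add_comm]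
    simp only [List.getD_cons_zero, List.getD_cons_succ]

theorem getD_succ_le {l : List ℕ} (hl : l.Pairwise (· ≥ ·)) (i : ℕ) :
    l.getD (i + 1) 0 ≤ l.getD i 0 := by
  rcases lt_or_ge (i + 1) l.length with h | h
  · rw [List.getD_eq_getElem _ _ h, List.getD_eq_getElem _ _ (by omega)]
    exact List.pairwise_iff_getElem.mp hl _ _ _ _ (Nat.lt_succ_self i)
  · rw [List.getD_eq_default _ _ h]
    exact Nat.zero_le _

section Stack

variable {d : ℕ} {s : Fin (d + 1)} {l : List ℕ} {A : Finset (Fin (d + 1) → ℤ)}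

/-- The set whose sections in direction `s` at the heights `1, 2, …` are the daisies with the
numbers of points listed in `l`. -/
def daisyStack {d : ℕ} (s : Fin (d + 1)) (l : List ℕ) : Finset (Fin (d + 1) → ℤ) :=
  (range l.length).biUnion fun i => (daisy d (l.getD i 0)).map (layerEmb s (i + 1))

theorem mem_daisyStack {x : Fin (d + 1) → ℤ} :
    x ∈ daisyStack s l ↔
      ∃ i < l.length, x s = i + 1 ∧ s.removeNth x ∈ daisy d (l.getD i 0) := by
  simp only [daisyStack, mem_biUnion, mem_range, mem_map_layerEmb]

theorem sectionAt_daisyStack (s : Fin (d + 1)) (l : List ℕ) (i : ℕ) :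
    sectionAt s (i + 1) (daisyStack s l) = daisy d (l.getD i 0) := by
  ext y
  simp only [mem_sectionAt, mem_daisyStack, layerEmb_apply_same, removeNth_layerEmb, add_left_inj,
    Nat.cast_inj]
  constructor
  · rintro ⟨_, _, rfl, h⟩
    exact h
  · refine fun h => ⟨i, ?_, rfl, h⟩
    by_contra! hi
    rw [List.getD_eq_default _ _ hi, daisy_zero_right] at h
    exact notMem_empty y h

/-- The heights `1, …, n`. -/
def stackHeights (n : ℕ) : Finset ℤ :=
  (range n).map ⟨fun i : ℕ => (i + 1 : ℤ), fun _ _ h => by simpa using h⟩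

theorem daisyStack_height_mem {x : Fin (d + 1) → ℤ} (hx : x ∈ daisyStack s l) :
    x s ∈ stackHeights l.length := by
  obtain ⟨i, hi, h, _⟩ := mem_daisyStack.mp hx
  exact mem_map.mpr ⟨i, mem_range.mpr hi, h.symm⟩

theorem sum_stackHeights (f : ℤ → ℕ) (n : ℕ) :
    ∑ k ∈ stackHeights n, f k = ∑ i ∈ range n, f (i + 1) :=
  sum_map _ _ _

theorem card_daisy_getD (hl : ∀ m ∈ l, #(daisy d m) = m) (i : ℕ) :
    #(daisy d (l.getD i 0)) = l.getD i 0 := by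
  rcases lt_or_ge i l.length with h | h
  · rw [List.getD_eq_getElem _ _ h]
    exact hl _ (List.getElem_mem h)
  · rw [List.getD_eq_default _ _ h, daisy_zero_right, card_empty]

theorem card_daisyStack (s : Fin (d + 1)) (hl : ∀ m ∈ l, #(daisy d m) = m) :
    #(daisyStack s l) = l.sum := by
  rw [← sum_card_sectionAt fun x => daisyStack_height_mem, sum_stackHeights]
  simp only [sectionAt_daisyStack, card_daisy_getD hl]
  simpa using sum_range_getD l (f := id) rfl le_rfl

theorem sum_tail_le_card_filter_daisyStack (s : Fin (d + 1)) (hl : ∀ m ∈ l, #(daisy d m) = m)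
    (hsort : l.Pairwise (· ≥ ·)) :
    l.tail.sum ≤ #{x ∈ daisyStack s l | x + Pi.single s 1 ∈ daisyStack s l} := by
  have htail : ∑ i ∈ range l.length, l.getD (i + 1) 0 = l.tail.sum := by
    simpa [List.getD] using sum_range_getD l.tail (f := id) rfl (n := l.length) (by simp)
  rw [← htail, ← sum_card_sectionAt (s := s) fun x hx =>
    daisyStack_height_mem (mem_filter.mp hx).1, sum_stackHeights]
  refine sum_le_sum fun i _ => ?_
  rw [← card_daisy_getD hl (i + 1)]
  refine card_le_card fun y hy => ?_
  have hy' := daisy_mono d (getD_succ_le hsort i) hy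
  rw [← sectionAt_daisyStack s, mem_sectionAt] at hy hy'
  rw [mem_sectionAt, mem_filter, layerEmb_add_single_self]
  exact ⟨hy', by exact_mod_cast hy⟩

/-- The number of inner edges of a stack of `d`-dimensional daisies of the sizes listed in `l`, in
decreasing order: those inside the layers, and one downwards for each point not in the lowest. -/
def stackEdges (d : ℕ) (l : List ℕ) : ℕ := (l.map (daisyEdges d)).sum + l.tail.sum

theorem stackEdges_le_innerEdges_daisyStack (s : Fin (d + 1)) (hl : ∀ m ∈ l, #(daisy d m) = m)
    (hsort : l.Pairwise (· ≥ ·)) : stackEdges d l ≤ innerEdges (daisyStack s l) := by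
  rw [innerEdges_eq_sum_sectionAt fun x => daisyStack_height_mem, sum_stackHeights, stackEdges,
    add_comm]
  simp only [sectionAt_daisyStack, innerEdges_daisy (card_daisy_getD hl _)]
  rw [sum_range_getD l (daisyEdges_zero_right d) le_rfl]
  exact Nat.add_le_add_right (sum_tail_le_card_filter_daisyStack s hl hsort) _

/-- The numbers of points of the nonempty sections of `A`, in decreasing order. -/
noncomputable def sectionSizes (s : Fin (d + 1)) (A : Finset (Fin (d + 1) → ℤ)) : List ℕ :=
  ((A.image (· s)).val.map fun k => #(sectionAt s k A)).sort (· ≥ ·)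

theorem pairwise_sectionSizes (s : Fin (d + 1)) (A : Finset (Fin (d + 1) → ℤ)) :
    (sectionSizes s A).Pairwise (· ≥ ·) :=
  Multiset.pairwise_sort _ _

theorem mem_sectionSizes {m : ℕ} :
    m ∈ sectionSizes s A ↔ ∃ k ∈ A.image (· s), #(sectionAt s k A) = m := by
  rw [sectionSizes, Multiset.mem_sort, Multiset.mem_map]
  rfl

theorem sum_map_sectionSizes (s : Fin (d + 1)) (A : Finset (Fin (d + 1) → ℤ)) (f : ℕ → ℕ) :
    ((sectionSizes s A).map f).sum = ∑ k ∈ A.image (· s), f #(sectionAt s k A) := by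
  rw [← Multiset.sum_coe, ← Multiset.map_coe, sectionSizes, Multiset.sort_eq, Multiset.map_map]
  rfl

theorem length_sectionSizes (s : Fin (d + 1)) (A : Finset (Fin (d + 1) → ℤ)) :
    (sectionSizes s A).length = #(A.image (· s)) := by
  rw [sectionSizes, Multiset.length_sort, Multiset.card_map, card_def]

theorem sum_sectionSizes (s : Fin (d + 1)) (A : Finset (Fin (d + 1) → ℤ)) :
    (sectionSizes s A).sum = #A := by
  rw [← sum_card_sectionAt fun x hx => mem_image_of_mem (· s) hx]
  simpa using sum_map_sectionSizes s A id

theorem card_daisy_of_mem_sectionSizes {m : ℕ} (hm : m ∈ sectionSizes s A) :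
    #(daisy d m) = m := by
  obtain ⟨k, -, rfl⟩ := mem_sectionSizes.mp hm
  exact card_daisy_of_le_card le_rfl

theorem innerEdges_le_stackEdges (hd : DaisiesAreOptimal d) (s : Fin (d + 1))
    (A : Finset (Fin (d + 1) → ℤ)) : innerEdges A ≤ stackEdges d (sectionSizes s A) := by
  rw [innerEdges_eq_sum_sectionAt fun x hx => mem_image_of_mem (· s) hx, stackEdges, add_comm,
    sum_map_sectionSizes]
  refine add_le_add (sum_le_sum fun k _ => hd _) ?_
  have hsum := sum_sectionSizes s A
  rcases h : sectionSizes s A with _ | ⟨a, t⟩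
  · rw [h, List.sum_nil, eq_comm, card_eq_zero] at hsum
    simp [hsum]
  · obtain ⟨k, -, rfl⟩ := mem_sectionSizes.mp (h ▸ List.mem_cons_self : a ∈ sectionSizes s A)
    have := card_filter_add_single_mem_le s k A
    rw [h, List.sum_cons] at hsum
    rw [List.tail_cons]
    omega

end Stack

section LayerRemoval

variable {d k l m n r N : ℕ}

theorem stackEdges_cons_orderedInsert (d a m : ℕ) (t : List ℕ) :
    stackEdges d (a :: t.orderedInsert (· ≥ ·) m) =
      stackEdges d (a :: t) + (m + daisyEdges d m) := by
  have hperm := t.perm_orderedInsert (· ≥ ·) m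
  simp only [stackEdges, List.map_cons, List.sum_cons, List.tail_cons, hperm.sum_eq,
    (hperm.map _).sum_eq]
  ring

/-- The new layer of `m` points is inserted into the list of section sizes of `A`; since it is not
the largest layer of the resulting stack, every one of its points gains a vertical edge. -/
theorem innerEdges_add_layer_le (hd : DaisiesAreOptimal d) (hd' : DaisiesAreOptimal (d + 1))
    {s : Fin (d + 1)} {h : ℤ} {A : Finset (Fin (d + 1) → ℤ)} (hm : m ≤ #(sectionAt s h A)) :
    innerEdges A + (m + daisyEdges d m) ≤ daisyEdges (d + 1) (#A + m) := by
  rcases m.eq_zero_or_pos with rfl | hm₀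
  · exact hd' A
  have hmem : #(sectionAt s h A) ∈ sectionSizes s A :=
    mem_sectionSizes.mpr ⟨h, sectionAt_nonempty_iff.mp (card_pos.mp (hm₀.trans_le hm)), rfl⟩
  have hcard (x) (hx : x ∈ sectionSizes s A) := card_daisy_of_mem_sectionSizes hx
  have hsort := pairwise_sectionSizes s A
  have hsum := sum_sectionSizes s A
  have hup := innerEdges_le_stackEdges hd s A
  generalize sectionSizes s A = L at *
  obtain _ | ⟨a, t⟩ := L
  · exact absurd hmem List.not_mem_nil
  have hperm := t.perm_orderedInsert (· ≥ ·) m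
  rw [List.pairwise_cons] at hsort
  have hma : m ≤ a := by
    rcases List.mem_cons.mp hmem with h | h
    · exact hm.trans_eq h
    · exact hm.trans (hsort.1 _ h)
  have hcard' : ∀ x ∈ a :: t.orderedInsert (· ≥ ·) m, #(daisy d x) = x := by
    simp only [List.forall_mem_cons, hperm.mem_iff] at hcard ⊢
    exact ⟨hcard.1, card_daisy_of_le_card hm, hcard.2⟩
  have hsort' : (a :: t.orderedInsert (· ≥ ·) m).Pairwise (· ≥ ·) := by
    simp only [List.pairwise_cons, hperm.mem_iff, List.forall_mem_cons]
    exact ⟨⟨hma, hsort.1⟩, hsort.2.orderedInsert m t⟩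
  calc innerEdges A + (m + daisyEdges d m)
      ≤ stackEdges d (a :: t.orderedInsert (· ≥ ·) m) := by
        rw [stackEdges_cons_orderedInsert]
        exact Nat.add_le_add_right hup _
    _ ≤ innerEdges (daisyStack s _) := stackEdges_le_innerEdges_daisyStack s hcard' hsort'
    _ ≤ daisyEdges (d + 1) #(daisyStack s _) := hd' _
    _ = daisyEdges (d + 1) (#A + m) := by
        rw [card_daisyStack s hcard', List.sum_cons, hperm.sum_eq, List.sum_cons, ← hsum,
          List.sum_cons, add_left_comm, add_comm m]

theorem exists_le_card_sectionAt_daisy (hN : d + 1 ≤ N) (hn : N / (d + 1) * l ≤ n)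
    (hl : l ≤ boxVolume d (faceIndex d N)) :
    ∃ h, l ≤ #(sectionAt (growthPos d N) h (daisy (d + 1) n)) := by
  let q := min n (boxVolume (d + 1) N)
  have hheight : ∀ x ∈ daisy (d + 1) q, x (growthPos d N) ∈ Icc (1 : ℤ) (N / (d + 1) : ℕ) :=
    fun x hx => mem_Icc.mpr
      (mem_balancedBox_growthPos.mp (daisy_subset_balancedBox (min_le_right _ _) hx)).1
  have hcard : #(Icc (1 : ℤ) (N / (d + 1) : ℕ)) * l ≤ #(daisy (d + 1) q) := by
    rw [Int.card_Icc, add_sub_cancel_right, Int.toNat_natCast, card_daisy_succ, le_min_iff,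
      boxVolume_eq_mul_face]
    exact ⟨hn, Nat.mul_le_mul_left _ hl⟩
  have hne : (Icc (1 : ℤ) (N / (d + 1) : ℕ)).Nonempty :=
    nonempty_Icc.mpr (by exact_mod_cast (Nat.one_le_div_iff d.succ_pos).mpr hN)
  obtain ⟨h, -, hh⟩ := exists_le_card_fiber_of_mul_le_card_of_maps_to hheight hne hcard
  rw [← card_sectionAt] at hh
  exact ⟨h, hh.trans (card_le_card fun y hy =>
    mem_sectionAt.mpr (daisy_mono _ (min_le_left _ _) (mem_sectionAt.mp hy)))⟩

theorem daisyEdges_exchange_beyond_box (hd : DaisiesAreOptimal d)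
    (hd' : DaisiesAreOptimal (d + 1)) (hN : d + 1 ≤ N) (hl : (N / (d + 1) + 1) * l ≤ r)
    (hr : r ≤ boxVolume (d + 1) (N + 1)) :
    daisyEdges (d + 1) (r - l) + daisyEdges (d + 1) (boxVolume (d + 1) N + l) ≤
      daisyEdges (d + 1) (boxVolume (d + 1) N) + daisyEdges (d + 1) r := by
  have hlface : l ≤ boxVolume d (faceIndex d N) := by
    rw [boxVolume_succ_eq_mul_face] at hr
    exact Nat.le_of_mul_le_mul_left (hl.trans hr) (Nat.succ_pos _)
  rw [Nat.succ_mul] at hl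
  obtain ⟨h, hh⟩ := exists_le_card_sectionAt_daisy hN (n := r - l) (by omega) hlface
  have hlayer := innerEdges_add_layer_le hd hd' hh
  rw [innerEdges_daisy (card_daisy_succ _ _), card_daisy_succ, Nat.sub_add_cancel (by omega)]
    at hlayer
  rw [daisyEdges_boxVolume_add hN hlface]
  omega

theorem boxVolume_lt_layer_bounds
    (hbm : boxVolume (d + 1) (faceIndex (d + 1) N) < m) (hmk : m ≤ k ^ (d + 1))
    (hkm : k * m ≤ boxVolume (d + 2) (N + 1) + r)
    (hr : r < boxVolume (d + 1) (faceIndex (d + 1) (N + 1))) :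
    (faceIndex (d + 1) N / (d + 1) + 1) * (m - boxVolume (d + 1) (faceIndex (d + 1) N)) ≤ r ∧
      r ≤ boxVolume (d + 1) (faceIndex (d + 1) N + 1) := by
  have hk : faceIndex (d + 1) N / (d + 1) < k :=
    lt_of_pow_lt_pow_left₀ (d + 1) k.zero_le
      ((pow_div_le_boxVolume _ _).trans_lt (hbm.trans_le hmk))
  obtain ⟨l, rfl⟩ := Nat.exists_eq_add_of_le hbm.le
  have hle := (Nat.mul_le_mul_right _ hk).trans hkm
  rw [boxVolume_succ_eq_mul_face (d + 1), mul_add] at hle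
  rw [Nat.add_sub_cancel_left]
  obtain ⟨a, j, hj, rfl⟩ := exists_eq_mul_add (d + 1) N
  rw [succ_mul_add_div hj] at hle
  rcases hj.lt_or_eq with hj' | rfl
  · -- The longest side of the face grows from level `N` to level `N + 1`.
    rw [add_assoc, faceIndex_mul_add hj'] at hr
    rw [faceIndex_mul_add hj, succ_mul_add_div (Nat.lt_succ_iff.mp hj')] at hle ⊢
    exact ⟨Nat.le_of_add_le_add_left hle, hr.le⟩
  · -- Both faces are the cube of side `a + 1`, and `m` exceeds its volume.
    rw [add_assoc, ← Nat.mul_succ, ← add_zero ((d + 1 + 1) * _), faceIndex_mul_add (Nat.zero_le _),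
      add_zero] at hr
    rw [faceIndex_mul_add le_rfl, ← Nat.mul_succ, Nat.mul_div_cancel_left _ d.succ_pos] at hle
    nlinarith

theorem daisyEdges_sub_layer_le_of_le (hd : DaisiesAreOptimal d) (hN : d + 1 ≤ N)
    (hr : r ≤ boxVolume d (faceIndex d N)) (hm : m ≤ r) :
    daisyEdges (d + 1) (boxVolume (d + 1) N + r - m) + (m + daisyEdges d m) ≤
      daisyEdges (d + 1) (boxVolume (d + 1) N + r) := by
  obtain ⟨q, rfl⟩ := Nat.exists_eq_add_of_le' hm
  have := daisyEdges_add_le hd hr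
  rw [Nat.add_sub_assoc hm, Nat.add_sub_cancel, daisyEdges_boxVolume_add hN hr,
    daisyEdges_boxVolume_add hN ((Nat.le_add_right q m).trans hr)]
  omega

theorem daisyEdges_face_exchange (hopt : ∀ e ≤ d, DaisiesAreOptimal e) (hN : d + 1 ≤ N)
    (hmk : m ≤ k ^ d) (hkm : k * m ≤ boxVolume (d + 1) (N + 1) + r)
    (hr : r < boxVolume d (faceIndex d (N + 1))) (hrm : r < m) :
    m ≤ boxVolume d (faceIndex d N) + r ∧
      daisyEdges d (boxVolume d (faceIndex d N) + r - m) + daisyEdges d m ≤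
        daisyEdges d (boxVolume d (faceIndex d N)) + daisyEdges d r := by
  rcases le_or_gt m (boxVolume d (faceIndex d N)) with hmb | hbm
  · have := daisyEdges_exchange (hopt d le_rfl) hmb (y := boxVolume d (faceIndex d N) + r - m)
      (by omega)
    rw [Nat.add_sub_of_le (by omega), min_eq_right (by omega), Nat.add_sub_cancel_left] at this
    omega
  obtain _ | d := d
  · have := boxVolume_pos (faceIndex 0 N).zero_le
    rw [pow_zero] at hmk
    omega
  obtain ⟨hl, hr'⟩ := boxVolume_lt_layer_bounds hbm hmk hkm hr
  have hP : d + 1 ≤ faceIndex (d + 1) N := le_faceIndex (by omega)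
  have := daisyEdges_exchange_beyond_box (hopt d d.le_succ) (hopt _ le_rfl) hP hl hr'
  rw [Nat.succ_mul] at hl
  obtain ⟨l, rfl⟩ := Nat.exists_eq_add_of_le hbm.le
  rw [Nat.add_sub_cancel_left] at *
  rw [Nat.add_sub_add_left]
  omega

theorem daisyEdges_sub_layer_le (hopt : ∀ e ≤ d, DaisiesAreOptimal e) (hmk : m ≤ k ^ d)
    (hkm : k * m ≤ n) (hmn : m < n) :
    daisyEdges (d + 1) (n - m) + (m + daisyEdges d m) ≤ daisyEdges (d + 1) n := by
  obtain ⟨N, r, hN, hr, rfl⟩ := exists_eq_boxVolume_add_of_pos d (m.zero_le.trans_lt hmn)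
  rcases le_or_gt m r with hmr | hrm
  · exact daisyEdges_sub_layer_le_of_le (hopt d le_rfl) hN hr.le hmr
  obtain ⟨M, rfl⟩ : ∃ M, N = M + 1 := Nat.exists_eq_add_one_of_ne_zero (by omega)
  have hM : d + 1 ≤ M := by
    by_contra! h
    obtain rfl : M = d := by omega
    have hface := faceIndex_mul_add M.zero_le 1
    rw [add_zero, add_zero, mul_one, mul_one] at hface
    rw [boxVolume_self] at hmn
    rw [hface, boxVolume_self] at hr
    omega
  obtain ⟨hle, hex⟩ := daisyEdges_face_exchange hopt hM hmk hkm hr hrm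
  have hsub : boxVolume (d + 1) (M + 1) + r - m =
      boxVolume (d + 1) M + (boxVolume d (faceIndex d M) + r - m) := by
    rw [boxVolume_succ]
    omega
  rw [daisyEdges_boxVolume_add hN hr.le, hsub, boxVolume_succ, daisyEdges_boxVolume_add hM le_rfl,
    daisyEdges_boxVolume_add hM (by omega)]
  omega

end LayerRemoval

theorem card_sectionAt_le {d n : ℕ} (s : Fin (d + 1)) (k : ℤ) {A : Finset (Fin (d + 1) → ℤ)}
    (h : ∀ i, #(A.image (· i)) ≤ n) : #(sectionAt s k A) ≤ n ^ d := by
  have hsub : sectionAt s k A ⊆ Fintype.piFinset fun i => A.image (· (s.succAbove i)) :=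
    fun y hy => Fintype.mem_piFinset.mpr fun i =>
      mem_image.mpr ⟨_, mem_sectionAt.mp hy, layerEmb_apply_succAbove s k y i⟩
  calc #(sectionAt s k A) ≤ ∏ i, #(A.image (· (s.succAbove i))) :=
        (card_le_card hsub).trans_eq (Fintype.card_piFinset _)
    _ ≤ n ^ d := by simpa using prod_le_prod' fun i (_ : i ∈ univ) => h (s.succAbove i)

theorem stackEdges_append_singleton (d m : ℕ) {l : List ℕ} (hl : l ≠ []) :
    stackEdges d (l ++ [m]) = stackEdges d l + (m + daisyEdges d m) := by
  simp only [stackEdges, List.map_append, List.sum_append, List.tail_append_of_ne_nil hl,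
    List.map_singleton, List.sum_singleton]
  ring

theorem length_mul_le_sum_append_singleton {m : ℕ} {l : List ℕ}
    (h : (l ++ [m]).Pairwise (· ≥ ·)) : (l ++ [m]).length * m ≤ (l ++ [m]).sum := by
  refine List.card_nsmul_le_sum _ _ fun x hx => ?_
  rcases List.mem_append.mp hx with hx | hx
  · exact (List.pairwise_append.mp h).2.2 x hx m (List.mem_singleton_self m)
  · exact (List.mem_singleton.mp hx).ge

/-- The direction `s` is one with the largest number of sections. -/
theorem exists_sectionSizes_eq_append {d : ℕ} {A : Finset (Fin (d + 1) → ℤ)} (hA : 1 < #A) :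
    ∃ s l m, sectionSizes s A = l ++ [m] ∧ l ≠ [] ∧ 0 < m ∧ m ≤ (l.length + 1) ^ d ∧
      (l.length + 1) * m ≤ #A := by
  obtain ⟨s, -, hs⟩ := exists_max_image univ (fun i => #(A.image (· i))) univ_nonempty
  have hsize (x) (hx : x ∈ sectionSizes s A) : 0 < x ∧ x ≤ (sectionSizes s A).length ^ d := by
    rw [length_sectionSizes]
    obtain ⟨h, hh, rfl⟩ := mem_sectionSizes.mp hx
    exact ⟨card_pos.mpr (sectionAt_nonempty_iff.mpr hh),
      card_sectionAt_le s h fun i => hs i (mem_univ i)⟩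
  have hsort := pairwise_sectionSizes s A
  have hsum := sum_sectionSizes s A
  obtain h | ⟨l, m, h⟩ := (sectionSizes s A).eq_nil_or_concat'
  · rw [h, List.sum_nil] at hsum
    omega
  rw [h] at hsize hsort hsum
  have hmin := length_mul_le_sum_append_singleton hsort
  obtain ⟨hm₀, hmk⟩ := hsize m (List.mem_append_right _ (List.mem_singleton_self m))
  rw [hsum] at hmin
  rw [List.length_append, List.length_singleton] at hmk hmin
  refine ⟨s, l, m, h, ?_, hm₀, hmk, hmin⟩
  rintro rfl
  simp only [List.length_nil, zero_add, one_pow, List.nil_append, List.sum_singleton] at hmk hsum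
  omega

theorem innerEdges_le_daisyEdges_of_lt {d : ℕ} (hopt : ∀ e ≤ d, DaisiesAreOptimal e)
    {A : Finset (Fin (d + 1) → ℤ)}
    (ih : ∀ B : Finset (Fin (d + 1) → ℤ), #B < #A → innerEdges B ≤ daisyEdges (d + 1) #B) :
    innerEdges A ≤ daisyEdges (d + 1) #A := by
  rcases le_or_gt #A 1 with hA | hA
  · exact (innerEdges_of_card_le_one hA).trans_le (Nat.zero_le _)
  obtain ⟨s, l, m, h, hl, hm₀, hmk, hmin⟩ := exists_sectionSizes_eq_append hA
  have hup := innerEdges_le_stackEdges (hopt d le_rfl) s A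
  have hsort := pairwise_sectionSizes s A
  have hsum := sum_sectionSizes s A
  rw [h] at hup hsort hsum
  rw [List.sum_append, List.sum_singleton] at hsum
  have hcard (x) (hx : x ∈ l) : #(daisy d x) = x :=
    card_daisy_of_mem_sectionSizes (h ▸ List.mem_append_left [m] hx)
  have hstack : #(daisyStack s l) = #A - m := by
    rw [card_daisyStack s hcard]
    omega
  have hmA : m < #A := by
    have := List.length_pos_iff.mpr hl
    nlinarith
  calc innerEdges A ≤ stackEdges d l + (m + daisyEdges d m) :=
        hup.trans_eq (stackEdges_append_singleton d m hl)
    _ ≤ innerEdges (daisyStack s l) + (m + daisyEdges d m) := Nat.add_le_add_right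
        (stackEdges_le_innerEdges_daisyStack s hcard (List.pairwise_append.mp hsort).1) _
    _ ≤ daisyEdges (d + 1) (#A - m) + (m + daisyEdges d m) :=
        Nat.add_le_add_right (hstack ▸ ih _ (by omega)) _
    _ ≤ daisyEdges (d + 1) #A := daisyEdges_sub_layer_le hopt hmk hmin hmA

theorem daisiesAreOptimal (d : ℕ) : DaisiesAreOptimal d := by
  induction d using Nat.strong_induction_on with
  | _ d ih =>
  obtain _ | d := d
  · intro A
    exact (innerEdges_of_card_le_one (card_le_one_of_subsingleton A)).trans_le (Nat.zero_le _)
  intro A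
  induction hA : #A using Nat.strong_induction_on generalizing A with
  | _ n ihA =>
  subst hA
  exact innerEdges_le_daisyEdges_of_lt (fun e he => ih e (Nat.lt_succ_of_le he))
    fun B hB => ihA _ hB B rfl

section Characterization

variable {d n N r : ℕ}

theorem balancedTuple_growthPos (d N : ℕ) :
    balancedTuple (d + 1) N (growthPos d N) = N / (d + 1) := by
  rw [balancedTuple_eq_insertNth, Fin.insertNth_apply_same]

theorem balancedTuple_succAbove (d N : ℕ) (i : Fin d) :
    balancedTuple (d + 1) N ((growthPos d N).succAbove i) = balancedTuple d (faceIndex d N) i := by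
  rw [balancedTuple_eq_insertNth, Fin.insertNth_apply_succAbove]

theorem balancedTuple_lt_castSucc_iff {j : Fin d} :
    balancedTuple (d + 1) N j.succ < balancedTuple (d + 1) N j.castSucc ↔
      j.succ = growthPos d N := by
  simp only [balancedTuple, growthPos, Fin.ext_iff, Fin.val_succ, Fin.val_castSucc]
  split_ifs <;> omega

theorem valueChange_balancedTuple (d N : ℕ) :
    valueChange (balancedTuple (d + 1) N) = growthPos d N := by
  unfold valueChange
  split_ifs with h
  · exact balancedTuple_lt_castSucc_iff.mp (Fin.find_spec h)
  · by_contra! hne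
    obtain ⟨j, hj⟩ := Fin.exists_succ_eq_of_ne_zero hne.symm
    exact h ⟨j, balancedTuple_lt_castSucc_iff.mpr hj⟩

theorem isDO1_balancedTuple (h : d ≤ N) : IsDO1 (balancedTuple d N) where
  pos := balancedTuple_pos h
  antitone i j (hij : (i : ℕ) ≤ j) := by
    unfold balancedTuple
    split_ifs <;> omega
  osc i j := by
    unfold balancedTuple
    split_ifs <;> omega

theorem IsDO1.exists_eq_balancedTuple {p : Fin d → ℕ} (hp : IsDO1 p) :
    ∃ N, d ≤ N ∧ p = balancedTuple d N := by
  obtain _ | d := d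
  · exact ⟨0, le_rfl, Subsingleton.elim _ _⟩
  let a := p (Fin.last d)
  have hex : ∃ j : Fin (d + 1), p j = a := ⟨Fin.last d, rfl⟩
  let j := Fin.find _ hex
  have hj : p j = a := Fin.find_spec hex
  refine ⟨(d + 1) * a + j, ?_, funext fun i => ?_⟩
  · have : 1 ≤ a := hp.pos _
    nlinarith
  rw [balancedTuple_mul_add j.isLt.le]
  have hlast : a ≤ p i := hp.antitone (Fin.le_last i)
  split_ifs with hij
  · have hne : p i ≠ a := Fin.find_min hex hij
    have hosc : p i ≤ a + 1 := hp.osc i _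
    omega
  · exact le_antisymm ((hp.antitone (not_lt.mp hij)).trans_eq hj) hlast

theorem coe_daisy_boxVolume_add (hr : r ≤ boxVolume d (faceIndex d N)) :
    (daisy (d + 1) (boxVolume (d + 1) N + r) : Set (Fin (d + 1) → ℤ)) =
      daisyBox (balancedTuple (d + 1) N) ∪
        (fun x => (valueChange (balancedTuple (d + 1) N)).insertNth (α := fun _ => ℤ)
          (balancedTuple (d + 1) N (valueChange (balancedTuple (d + 1) N)) + 1 : ℤ) x) ''
            (daisy d r : Set (Fin d → ℤ)) := by
  rw [daisy_boxVolume_add hr, valueChange_balancedTuple, balancedTuple_growthPos, coe_union,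
    coe_balancedBox, coe_map, Nat.cast_succ]
  rfl

theorem lt_of_balancedTuple_lt {M : ℕ} {i : Fin d} (h : balancedTuple d M i < balancedTuple d N i) :
    M < N :=
  lt_of_not_ge fun hNM => (balancedTuple_mono d hNM i).not_gt h

theorem tupleLT_balancedTuple_iff {M : ℕ} :
    TupleLT (balancedTuple d M) (balancedTuple (d + 1) N) ↔
      ∃ i, balancedTuple d M i < balancedTuple d (faceIndex d N) i := by
  simp only [TupleLT, valueChange_balancedTuple, balancedTuple_succAbove, and_iff_right_iff_imp]
  rintro ⟨i, hi⟩
  exact balancedTuple_mono d (lt_of_balancedTuple_lt hi).le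

theorem IsDaisyWith.exists_eq_daisy {p : Fin d → ℕ} {Q : Set (Fin d → ℤ)}
    (hQ : IsDaisyWith p Q) :
    ∃ N n, p = balancedTuple d N ∧ Q = daisy d n ∧ #(daisy d n) = n ∧
      (0 < d → n < boxVolume d (N + 1)) := by
  induction hQ with
  | @perfect d p hp =>
    obtain ⟨N, hN, rfl⟩ := hp.exists_eq_balancedTuple
    refine ⟨N, boxVolume d N, rfl, ?_, card_daisy le_rfl, fun hd => ?_⟩
    · rw [daisy_boxVolume, coe_balancedBox]
    · obtain ⟨d, rfl⟩ := Nat.exists_eq_add_one_of_ne_zero hd.ne'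
      have := boxVolume_pos (le_faceIndex (d.le_succ.trans hN))
      rw [boxVolume_succ]
      omega
  | @layer d p hp q R hR hlt ih =>
    obtain ⟨N, -, rfl⟩ := hp.exists_eq_balancedTuple
    obtain ⟨M, r, rfl, rfl, -, hr⟩ := ih
    obtain ⟨i, hi⟩ := tupleLT_balancedTuple_iff.mp hlt
    have hr' : r < boxVolume d (faceIndex d N) :=
      (hr i.pos).trans_le (boxVolume_mono d (lt_of_balancedTuple_lt hi))
    refine ⟨N, boxVolume (d + 1) N + r, rfl, ?_, card_daisy_succ _ _, fun _ => ?_⟩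
    · rw [coe_daisy_boxVolume_add hr'.le]
    · rw [boxVolume_succ]
      omega

theorem IsDaisy.eq_daisy {Q : Set (Fin d → ℤ)} (hQ : IsDaisy Q) (hn : Q.encard = n) :
    Q = daisy d n := by
  obtain ⟨p, hp⟩ := hQ
  obtain ⟨N, m, -, rfl, hm, -⟩ := hp.exists_eq_daisy
  rw [Set.encard_coe_eq_coe_finsetCard, hm, Nat.cast_inj] at hn
  rw [hn]

theorem exists_isDaisyWith_daisy (hn : 0 < n) (hcard : #(daisy d n) = n) :
    ∃ N, boxVolume d N ≤ n ∧ IsDaisyWith (balancedTuple d N) (daisy d n : Set (Fin d → ℤ)) := by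
  have hperfect {d N : ℕ} (hN : d ≤ N) :
      IsDaisyWith (balancedTuple d N) (daisy d (boxVolume d N) : Set (Fin d → ℤ)) := by
    rw [daisy_boxVolume, coe_balancedBox]
    exact .perfect _ (isDO1_balancedTuple hN)
  induction d generalizing n with
  | zero =>
    obtain rfl : n = boxVolume 0 0 := by
      rw [boxVolume_self]
      exact le_antisymm (hcard.symm.trans_le (card_le_one_of_subsingleton _)) hn
    exact ⟨0, le_rfl, hperfect le_rfl⟩
  | succ d ih =>
    obtain ⟨N, r, hN, hr, rfl⟩ := exists_eq_boxVolume_add_of_pos d hn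
    refine ⟨N, Nat.le_add_right _ _, ?_⟩
    rcases r.eq_zero_or_pos with rfl | hr₀
    · exact hperfect hN
    obtain ⟨M, hM, hdaisy⟩ := ih hr₀ (card_daisy hr.le)
    rw [coe_daisy_boxVolume_add hr.le]
    refine .layer _ (isDO1_balancedTuple hN) _ _ hdaisy (tupleLT_balancedTuple_iff.mpr ?_)
    by_contra! h
    exact (hM.trans_lt hr).not_ge (prod_le_prod' fun i _ => h i)

theorem isDaisy_daisy (hn : 0 < n) (hcard : #(daisy d n) = n) :
    IsDaisy (daisy d n : Set (Fin d → ℤ)) :=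
  let ⟨N, _, h⟩ := exists_isDaisyWith_daisy hn hcard
  ⟨balancedTuple d N, h⟩

end Characterization

section Perimeter

variable {d : ℕ}

/-- The step of length one along the `t.1`-th coordinate axis, with sign `t.2`. -/
def unitStep (t : Fin d × ℤˣ) : Fin d → ℤ := Pi.single t.1 (t.2 : ℤ)

theorem unitStep_injective : Function.Injective (unitStep (d := d)) := by
  rintro ⟨i, ε⟩ ⟨j, δ⟩ h
  have hi : unitStep (j, δ) i ≠ 0 := by
    rw [← h]
    simp [unitStep]
  obtain rfl : i = j := by
    by_contra hij
    exact hi (Pi.single_eq_of_ne hij _)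
  exact congrArg (i, ·) (Units.ext (Pi.single_injective i h))

theorem sum_sq_eq_one_iff {z : Fin d → ℤ} : ∑ i, z i ^ 2 = 1 ↔ ∃ t, unitStep t = z := by
  constructor
  · intro h
    obtain ⟨i, hi⟩ : ∃ i, z i ≠ 0 := by
      by_contra! h₀
      simp [h₀] at h
    have hother : 0 ≤ ∑ k ∈ univ.erase i, z k ^ 2 := sum_nonneg fun k _ => sq_nonneg _
    have hpos : 0 < z i ^ 2 := by positivity
    rw [← add_sum_erase _ _ (mem_univ i)] at h
    have hzero := (sum_eq_zero_iff_of_nonneg fun k _ => sq_nonneg _).mp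
      (show ∑ k ∈ univ.erase i, z k ^ 2 = 0 by omega)
    refine ⟨(i, Units.ofPowEqOne (z i) 2 (by omega) two_ne_zero), funext fun k => ?_⟩
    rcases eq_or_ne k i with rfl | hk
    · simp [unitStep]
    · simpa [unitStep, hk] using (pow_eq_zero_iff two_ne_zero |>.mp (hzero k (by simp [hk]))).symm
  · rintro ⟨⟨i, ε⟩, rfl⟩
    rw [sum_eq_single i (fun k _ hk => by simp [unitStep, hk]) (by simp)]
    rw [unitStep, Pi.single_eq_same, ← Units.val_pow_eq_pow_val, Int.units_sq, Units.val_one]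

theorem edgeBoundary_coe (A : Finset (Fin d → ℤ)) :
    edgeBoundary (A : Set (Fin d → ℤ)) =
      ({p ∈ univ ×ˢ A | p.2 + unitStep p.1 ∉ A} : Finset _).image
        fun p => (p.2, p.2 + unitStep p.1) := by
  ext ⟨x, y⟩
  have hdist : ∑ i, (x i - y i) ^ 2 = 1 ↔ ∃ t, x + unitStep t = y := by
    rw [sum_congr rfl fun i _ => sub_sq_comm (x i) (y i)]
    exact sum_sq_eq_one_iff.trans (exists_congr fun t => eq_sub_iff_add_eq')
  simp only [edgeBoundary, Set.mem_ofPred_eq, hdist, mem_coe, coe_image, Set.mem_image,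
    mem_filter, mem_product, mem_univ, true_and, Prod.mk.injEq]
  constructor
  · rintro ⟨⟨t, rfl⟩, hx, hy⟩
    exact ⟨(t, x), ⟨hx, hy⟩, rfl, rfl⟩
  · rintro ⟨⟨t, x⟩, ⟨hx, hy⟩, rfl, rfl⟩
    exact ⟨⟨t, rfl⟩, hx, hy⟩

theorem edgePerimeter_eq_sum (A : Finset (Fin d → ℤ)) :
    edgePerimeter (A : Set (Fin d → ℤ)) = (∑ t, #{x ∈ A | x + unitStep t ∉ A} : ℕ) := by
  have hinj : Function.Injective
      fun p : (Fin d × ℤˣ) × (Fin d → ℤ) => (p.2, p.2 + unitStep p.1) := by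
    rintro ⟨t, x⟩ ⟨t', x'⟩ h
    obtain ⟨rfl, h⟩ := Prod.mk.inj h
    exact congrArg (·, x) (unitStep_injective (add_left_cancel h))
  rw [edgePerimeter, edgeBoundary_coe, Set.encard_coe_eq_coe_finsetCard,
    card_image_of_injective _ hinj]
  simp only [card_filter, sum_product]

theorem card_filter_add_unitStep_mem (A : Finset (Fin d → ℤ)) (t : Fin d × ℤˣ) :
    #{x ∈ A | x + unitStep t ∈ A} = #{x ∈ A | x + Pi.single t.1 1 ∈ A} := by
  obtain ⟨i, ε⟩ := t
  rcases Int.units_eq_one_or ε with rfl | rfl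
  · rfl
  refine card_equiv (Equiv.addRight (unitStep (i, -1))) fun x => ?_
  have hback : x + unitStep (i, -1) + Pi.single i 1 = x := by simp [unitStep, Pi.single_neg]
  simp only [mem_filter, Equiv.coe_addRight, hback, and_comm]

theorem edgePerimeter_coe (A : Finset (Fin d → ℤ)) :
    edgePerimeter (A : Set (Fin d → ℤ)) = (2 * (d * #A - innerEdges A) : ℕ) := by
  have hinner : ∑ t, #{x ∈ A | x + unitStep t ∈ A} = 2 * innerEdges A := by
    simp only [card_filter_add_unitStep_mem, Fintype.sum_prod_type, innerEdges, mul_sum]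
    simp
  have htotal : ∑ t, #{x ∈ A | x + unitStep t ∈ A} + ∑ t, #{x ∈ A | x + unitStep t ∉ A} =
      2 * (d * #A) := by
    simp only [← sum_add_distrib, card_filter_add_card_filter_not, sum_const, card_univ,
      Fintype.card_prod, Fintype.card_fin, Fintype.card_units_int, smul_eq_mul]
    ring
  rw [edgePerimeter_eq_sum]
  congr 1
  omega

end Perimeter

theorem exists_antitone_equiv {α β : Type*} [Finite α] [LinearOrder β] (f : α → β) :
    ∃ (n : ℕ) (σ : Fin n ≃ α), Antitone (f ∘ σ) := by
  let e := (Finite.equivFin α).symm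
  let g : Fin (Nat.card α) → βᵒᵈ := OrderDual.toDual ∘ f ∘ e
  exact ⟨_, (Tuple.sort g).trans e, fun i j hij => Tuple.monotone_sort g hij⟩

section Rearrangement

variable {d n : ℕ} {s : Fin (d + 1)} {A : Finset (Fin (d + 1) → ℤ)} {C' : Set (Fin (d + 1) → ℤ)}

theorem removeNth_image_latticeSection (s : Fin (d + 1)) (k : ℤ) (C : Set (Fin (d + 1) → ℤ)) :
    s.removeNth '' latticeSection s k C = layerEmb s k ⁻¹' C := by
  ext y
  constructor
  · rintro ⟨x, ⟨hx, rfl⟩, rfl⟩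
    rwa [Set.mem_preimage, layerEmb_removeNth]
  · exact fun hy => ⟨_, ⟨hy, layerEmb_apply_same s k y⟩, removeNth_layerEmb s k y⟩

theorem latticeSection_coe_nonempty_iff {k : ℤ} :
    (latticeSection s k (A : Set (Fin (d + 1) → ℤ))).Nonempty ↔ k ∈ A.image (· s) := by
  rw [mem_image]
  rfl

theorem encard_latticeSection_coe (k : ℤ) :
    (latticeSection s k (A : Set (Fin (d + 1) → ℤ))).encard = #(sectionAt s k A) := by
  rw [card_sectionAt, ← Set.encard_coe_eq_coe_finsetCard, coe_filter]
  rfl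

theorem exists_antitone_card_sectionAt (s : Fin (d + 1)) (A : Finset (Fin (d + 1) → ℤ)) :
    ∃ (n : ℕ) (σ : Fin n ≃ {k : ℤ // (latticeSection s k (A : Set (Fin (d + 1) → ℤ))).Nonempty}),
      Antitone fun i => #(sectionAt s (σ i) A) := by
  have : Finite {k : ℤ // (latticeSection s k (A : Set (Fin (d + 1) → ℤ))).Nonempty} := by
    simp only [latticeSection_coe_nonempty_iff]
    infer_instance
  exact exists_antitone_equiv fun
    k : {k : ℤ // (latticeSection s k (A : Set (Fin (d + 1) → ℤ))).Nonempty} => #(sectionAt s k A)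

theorem sectionSizes_eq_ofFn
    (σ : Fin n ≃ {k : ℤ // (latticeSection s k (A : Set (Fin (d + 1) → ℤ))).Nonempty})
    (hσ : Antitone fun i => #(sectionAt s (σ i) A)) :
    sectionSizes s A = List.ofFn fun i => #(sectionAt s (σ i) A) := by
  have himage : univ.map (σ.toEmbedding.trans (.subtype _)) = A.image (· s) := by
    ext k
    rw [← latticeSection_coe_nonempty_iff, mem_map]
    exact ⟨by rintro ⟨i, -, rfl⟩; exact (σ i).2, fun h => ⟨σ.symm ⟨k, h⟩, mem_univ _, by simp⟩⟩
  refine List.Perm.eq_of_pairwise' (pairwise_sectionSizes s A) ?_ ?_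
  · exact List.pairwise_ofFn.mpr fun i j hij => hσ hij.le
  · rw [← Multiset.coe_eq_coe, sectionSizes, Multiset.sort_eq, ← himage, map_val,
      Multiset.map_map, Fin.univ_val_map]
    rfl

theorem removeNth_image_latticeSection_daisyStack_ofFn (s : Fin (d + 1)) (f : Fin n → ℕ)
    (i : Fin n) :
    s.removeNth '' latticeSection s ((i : ℤ) + 1) (daisyStack s (List.ofFn f)) =
      (daisy d (f i) : Set (Fin d → ℤ)) := by
  have hget : (List.ofFn f).getD i 0 = f i := by simp
  rw [removeNth_image_latticeSection, ← hget, ← sectionAt_daisyStack s, sectionAt, coe_preimage]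

theorem eq_daisyStack_ofFn_iff {f : Fin n → ℕ} (hf : ∀ i, 0 < f i) :
    C' = daisyStack s (List.ofFn f) ↔
      (∀ k : ℤ, (latticeSection s k C').Nonempty ↔ 1 ≤ k ∧ k ≤ n) ∧
        ∀ i : Fin n, s.removeNth '' latticeSection s ((i : ℤ) + 1) C' = daisy d (f i) := by
  have hindex {k : ℤ} (hk : 1 ≤ k ∧ k ≤ n) : ∃ i : Fin n, (i : ℤ) + 1 = k :=
    ⟨⟨(k - 1).toNat, by omega⟩, by simp only; omega⟩
  have hstack := removeNth_image_latticeSection_daisyStack_ofFn s f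
  have hheight {x : Fin (d + 1) → ℤ} (hx : x ∈ daisyStack s (List.ofFn f)) :
      1 ≤ x s ∧ x s ≤ n := by
    obtain ⟨i, hi, hxs, -⟩ := mem_daisyStack.mp hx
    rw [List.length_ofFn] at hi
    omega
  constructor
  · rintro rfl
    refine ⟨fun k => ⟨?_, fun hk => ?_⟩, hstack⟩
    · rintro ⟨x, hx, rfl⟩
      exact hheight hx
    · obtain ⟨i, rfl⟩ := hindex hk
      rw [← Set.image_nonempty, hstack]
      exact daisy_nonempty (hf i)
  · rintro ⟨hC', hsec⟩
    have heq {x : Fin (d + 1) → ℤ} (hx : 1 ≤ x s ∧ x s ≤ n) :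
        x ∈ C' ↔ x ∈ (daisyStack s (List.ofFn f) : Set (Fin (d + 1) → ℤ)) := by
      obtain ⟨i, hi⟩ := hindex hx
      have h := (hsec i).trans (hstack i).symm
      rw [removeNth_image_latticeSection, removeNth_image_latticeSection, hi] at h
      simpa only [Set.mem_preimage, layerEmb_removeNth] using Set.ext_iff.mp h (s.removeNth x)
    ext x
    exact ⟨fun hx => (heq ((hC' _).mp ⟨x, hx, rfl⟩)).mp hx, fun hx => (heq (hheight hx)).mpr hx⟩

theorem isDecreasingRearrangement_coe_iff :
    IsDecreasingRearrangement s (A : Set (Fin (d + 1) → ℤ)) C' ↔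
      C' = daisyStack s (sectionSizes s A) := by
  have hpos (k : {k : ℤ // (latticeSection s k (A : Set (Fin (d + 1) → ℤ))).Nonempty}) :
      0 < #(sectionAt s k A) :=
    card_pos.mpr (sectionAt_nonempty_iff.mpr (latticeSection_coe_nonempty_iff.mp k.2))
  constructor
  · rintro ⟨n, σ, hanti, hheight, hsec⟩
    simp only [encard_latticeSection_coe, Nat.cast_le] at hanti hsec
    rw [sectionSizes_eq_ofFn σ hanti, eq_daisyStack_ofFn_iff fun i => hpos _]
    exact ⟨hheight, fun i => (hsec i).1.eq_daisy (hsec i).2⟩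
  · obtain ⟨n, σ, hanti⟩ := exists_antitone_card_sectionAt s A
    rw [sectionSizes_eq_ofFn σ hanti, eq_daisyStack_ofFn_iff fun i => hpos _]
    rintro ⟨hheight, hsec⟩
    refine ⟨n, σ, fun i j hij => ?_, hheight, fun i => ?_⟩
    · rw [encard_latticeSection_coe, encard_latticeSection_coe]
      exact_mod_cast hanti hij
    · have hcard := card_daisy_of_le_card (le_refl #(sectionAt s (σ i) A))
      rw [hsec i, encard_latticeSection_coe, Set.encard_coe_eq_coe_finsetCard, hcard]
      exact ⟨isDaisy_daisy (hpos _) hcard, rfl⟩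

end Rearrangement

theorem proposition3p2 {d : ℕ} (C : Set (Fin (d + 1) → ℤ)) (hne : C.Nonempty)
    (hC : Bornology.IsBounded C) (s : Fin (d + 1)) :
    (∃! C' : Set (Fin (d + 1) → ℤ), IsDecreasingRearrangement s C C') ∧
      ∀ C' : Set (Fin (d + 1) → ℤ), IsDecreasingRearrangement s C C' →
        edgePerimeter C' ≤ edgePerimeter C := by
  have hfin : C.Finite := (hC.isCompact_closure.finite_of_discrete).subset subset_closure
  obtain ⟨A, rfl⟩ := hfin.exists_finset_coe
  simp only [isDecreasingRearrangement_coe_iff, existsUnique_eq, forall_eq, true_and]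
  have hdaisy (m) (hm : m ∈ sectionSizes s A) := card_daisy_of_mem_sectionSizes hm
  have hcard : #(daisyStack s (sectionSizes s A)) = #A := by
    rw [card_daisyStack s hdaisy, sum_sectionSizes]
  have hinner : innerEdges A ≤ innerEdges (daisyStack s (sectionSizes s A)) :=
    (innerEdges_le_stackEdges (daisiesAreOptimal d) s A).trans
      (stackEdges_le_innerEdges_daisyStack s hdaisy (pairwise_sectionSizes s A))
  rw [edgePerimeter_coe, edgePerimeter_coe, hcard]
  exact_mod_cast Nat.mul_le_mul_left 2 (Nat.sub_le_sub_left hinner _)
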